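/- \textbf{Theorem (Precision and Recall Tradeoff).} Let $n>m\ge 0$ be integers and let $M\subset\mathbb{R}^N$ be a smooth embedded $n$-dimensional submanifold (with the Riemannian structure induced from $\mathbb{R}^N$). Let $\mathrm{Vol}_n$ denote $n$-dimensional Hausdorff (outer) measure on $M$, normalized to agree with Lebesgue measure on $\mathbb{R}^n$. For an arbitrary (not necessarily continuous or measurable) map $f:M\to\mathbb{R}^m$, a point $x\in M$ and radii $r_U,r_V>0$, put $U=B_{r_U}(x)\cap M$ (Euclidean open ball) and $V=B_{r_V}(f(x))\subset\mathbb{R}^m$, and $$\mathrm{Precision}^f(U,V)=\frac{\mathrm{Vol}_n(f^{-1}(V)\cap U)}{\mathrm{Vol}_n(f^{-1}(V))},\qquad \mathrm{Recall}^f(U,V)=\frac{\mathrm{Vol}_n(f^{-1}(V)\cap U)}{\mathrm{Vol}_n(U)},$$ where ratios of the form $0/0$ and $\infty/\infty$ are not regarded as equal to $1$. Say that $f$ achieves perfect precision at $x$ if for every $r_U>0$ there is $r_V>0$ with $\mathrm{Precision}^f(U,V)=1$, and perfect recall at $x$ if for every $r_V>0$ there is $r_U>0$ such that $f^{-1}(V)\cap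 U$ is $\mathrm{Vol}_n$-measurable (i.e. differs from a Borel set by a null set) and $\mathrm{Recall}^f(U,V)=1$. Say that $f$ achieves perfect precision (recall) on a set $W\subset M$ if it does so at every $w\in W$. Then for every map $f:M\to\mathbb{R}^m$ and every nonempty open subset $W$ of $M$, $f$ does not achieve both perfect precision and perfect recall on $W$. -/

import Mathlib

open Set Metric MeasureTheory Manifold
open scoped ENNReal ContDiff

noncomputable section

/-- The precision of `f` at the ball `U` of radius `rU` about `x` and the ball `V` of radius `rV`
about `f x`: the ratio `Vol_n (f⁻¹(V) ∩ U) / Vol_n (f⁻¹(V))`, where `Vol_n` is the `n`-dimensional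
Hausdorff (outer) measure, normalized so that it is Lebesgue measure on Euclidean `n`-space.
The degenerate ratios `0 / 0` and `∞ / ∞` have the value `0` in `ℝ≥0∞`. -/
def setPrecision {X Y : Type*} [MetricSpace X] [MeasurableSpace X] [BorelSpace X] [MetricSpace Y]
    (n : ℕ) (f : X → Y) (x : X) (rU rV : ℝ) : ℝ≥0∞ :=
  (μHE[n] : Measure X) (f ⁻¹' ball (f x) rV ∩ ball x rU) /
    (μHE[n] : Measure X) (f ⁻¹' ball (f x) rV)

/-- The recall of `f` at the ball `U` of radius `rU` about `x` and the ball `V` of radius `rV`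
about `f x`: the ratio `Vol_n (f⁻¹(V) ∩ U) / Vol_n (U)`. -/
def setRecall {X Y : Type*} [MetricSpace X] [MeasurableSpace X] [BorelSpace X] [MetricSpace Y]
    (n : ℕ) (f : X → Y) (x : X) (rU rV : ℝ) : ℝ≥0∞ :=
  (μHE[n] : Measure X) (f ⁻¹' ball (f x) rV ∩ ball x rU) / (μHE[n] : Measure X) (ball x rU)

/-- `f` achieves perfect precision at `x`. -/
def PerfectPrecisionAt {X Y : Type*} [MetricSpace X] [MeasurableSpace X] [BorelSpace X]
    [MetricSpace Y] (n : ℕ) (f : X → Y) (x : X) : Prop :=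
  ∀ rU : ℝ, 0 < rU → ∃ rV : ℝ, 0 < rV ∧ setPrecision n f x rU rV = 1

/-- `f` achieves perfect recall at `x`. As `f` is arbitrary, `f⁻¹(V) ∩ U` need not be measurable;
perfect recall includes that it is (up to a null set), so that a recall of `1` does mean that
`U ⊆ f⁻¹(V)` up to a set of volume zero. -/
def PerfectRecallAt {X Y : Type*} [MetricSpace X] [MeasurableSpace X] [BorelSpace X]
    [MetricSpace Y] (n : ℕ) (f : X → Y) (x : X) : Prop :=
  ∀ rV : ℝ, 0 < rV → ∃ rU : ℝ, 0 < rU ∧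
    NullMeasurableSet (f ⁻¹' ball (f x) rV ∩ ball x rU) (μHE[n] : Measure X) ∧
    setRecall n f x rU rV = 1

/-- `f` achieves perfect precision in the set `W`. -/
def PerfectPrecisionOn {X Y : Type*} [MetricSpace X] [MeasurableSpace X] [BorelSpace X]
    [MetricSpace Y] (n : ℕ) (f : X → Y) (W : Set X) : Prop :=
  ∀ w ∈ W, PerfectPrecisionAt n f w

/-- `f` achieves perfect recall in the set `W`. -/
def PerfectRecallOn {X Y : Type*} [MetricSpace X] [MeasurableSpace X] [BorelSpace X]
    [MetricSpace Y] (n : ℕ) (f : X → Y) (W : Set X) : Prop :=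
  ∀ w ∈ W, PerfectRecallAt n f w

end

/-! Nonempty open subsets of `M` have positive volume, so conditions that hold almost everywhere on
balls become pointwise. Perfect recall makes `f` continuous on `W`: two overlapping balls share a
point where `f` is close to both central values. Given continuity, perfect precision makes `f`
injective on `W`: a second point of the same fibre would bring an open set of positive volume into
`f⁻¹(V)` outside `U`. A chart then yields a continuous injection of an open subset of `ℝⁿ` into `ℝᵐ`
with `m < n`.

That is impossible by a Brouwer-type argument: the no-retraction theorem, proved by comparing
volumes under `id + t g`, gives zeros of maps near the identity, and such a map without zeros could
be built by factoring through `ℝᵐ`. -/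

/-! ### Determinants of perturbations of the identity -/

theorem Matrix.det_one_add_eq_sum_lagrange {k : ℕ} (A : Matrix (Fin k) (Fin k) ℝ) {v : ℕ → ℝ}
    (hv : Set.InjOn v (Finset.range (k + 1))) :
    (1 + A).det = ∑ i ∈ Finset.range (k + 1),
      (Lagrange.basis (Finset.range (k + 1)) v i).eval 1 * (1 + v i • A).det := by
  -- `det (1 + tA)` is a polynomial in `t` of degree at most `k`, so `k + 1` nodes determine its
  -- value at `1`.
  set p : Polynomial ℝ :=
    ((Polynomial.X : Polynomial ℝ) • A.map Polynomial.C +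
      (1 : Matrix (Fin k) (Fin k) ℝ).map Polynomial.C).det with hp
  have hev : ∀ t : ℝ, p.eval t = (1 + t • A).det := by
    intro t
    rw [hp, ← Polynomial.coe_evalRingHom, RingHom.map_det]
    congr 1
    ext i j
    by_cases h : i = j <;> simp [h] <;> ring
  have hdeg : p.degree < (Finset.range (k + 1)).card := by
    have h1 : p.natDegree ≤ Fintype.card (Fin k) :=
      Polynomial.natDegree_det_X_add_C_le A 1
    refine lt_of_le_of_lt Polynomial.degree_le_natDegree ?_
    simp only [Fintype.card_fin] at h1
    simp only [Finset.card_range, Nat.cast_lt]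
    lia
  have h := congrArg (Polynomial.eval 1) (Lagrange.eq_interpolate hv hdeg)
  rw [Lagrange.interpolate_apply, Polynomial.eval_finsetSum, hev] at h
  simp only [one_smul, Polynomial.eval_mul, Polynomial.eval_C, hev] at h
  rw [h]
  exact Finset.sum_congr rfl fun i _ => mul_comm _ _

theorem ContinuousLinearMap.det_one_add_eq_sum_lagrange {E : Type*} [NormedAddCommGroup E]
    [NormedSpace ℝ E] [FiniteDimensional ℝ E] (A : E →L[ℝ] E) {v : ℕ → ℝ}
    (hv : Set.InjOn v (Finset.range (Module.finrank ℝ E + 1))) :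
    (1 + A).det = ∑ i ∈ Finset.range (Module.finrank ℝ E + 1),
      (Lagrange.basis (Finset.range (Module.finrank ℝ E + 1)) v i).eval 1 *
        (1 + v i • A).det := by
  let b := Module.finBasis ℝ E
  have hdet : ∀ t : ℝ, (1 + t • A).det =
      (1 + t • LinearMap.toMatrix b b (A : _ →ₗ[ℝ] _)).det := by
    intro t
    rw [ContinuousLinearMap.det, ← LinearMap.det_toMatrix b]
    congr 1
    have : ((1 + t • A : E →L[ℝ] E) : E →ₗ[ℝ] E) =
      LinearMap.id + t • (A : _ →ₗ[ℝ] _) := rfl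
    rw [this, map_add, map_smul, LinearMap.toMatrix_id]
  have h1 := hdet 1
  simp only [one_smul] at h1
  rw [h1, Matrix.det_one_add_eq_sum_lagrange _ hv]
  simp only [hdet]

/-- By the Neumann series `1 + tA` stays invertible for `t ∈ [0, 1]`, so its determinant keeps the
sign it has at `t = 0`. -/
theorem ContinuousLinearMap.det_one_add_pos_of_norm_lt_one {E : Type*} [NormedAddCommGroup E]
    [NormedSpace ℝ E] [FiniteDimensional ℝ E] {A : E →L[ℝ] E} (hA : ‖A‖ < 1) :
    0 < (1 + A).det := by
  have : CompleteSpace E := FiniteDimensional.complete ℝ E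
  have hne : ∀ t ∈ Icc (0 : ℝ) 1, (1 + t • A).det ≠ 0 := by
    intro t ht
    have hlt : ‖-(t • A)‖ < 1 := by
      rw [norm_neg, norm_smul, Real.norm_of_nonneg ht.1]
      nlinarith [ht.2, norm_nonneg A]
    have hu : IsUnit (1 + t • A) := by
      have := (Units.oneSub _ hlt).isUnit
      simpa using this
    obtain ⟨u, hu⟩ := hu
    have hmul : (1 + t • A) * (↑u⁻¹ : _ →L[ℝ] _) = 1 := by rw [← hu]; simp
    intro h0
    have h2 : LinearMap.det (((1 + t • A) * (↑u⁻¹ : _ →L[ℝ] _) : _ →L[ℝ] _) :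
      E →ₗ[ℝ] E) = 1 := by
      rw [hmul]; exact LinearMap.det_id
    rw [ContinuousLinearMap.toLinearMap_mul, map_mul] at h2
    rw [ContinuousLinearMap.det] at h0
    rw [h0, zero_mul] at h2
    exact zero_ne_one h2
  by_contra hcon
  have hc : ContinuousOn (fun t : ℝ => (1 + t • A).det) (Icc 0 1) :=
    (ContinuousLinearMap.continuous_det.comp (by fun_prop)).continuousOn
  have h0 : (1 + (0 : ℝ) • A).det = 1 := by
    have : 1 + (0 : ℝ) • A = 1 := by simp
    rw [this]; exact LinearMap.det_id
  have := intermediate_value_Icc' (zero_le_one' ℝ) hc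
  obtain ⟨t, ht, ht0⟩ := this (show (0 : ℝ) ∈ _ by
    refine ⟨?_, ?_⟩
    · simpa using hcon
    · simp only [h0]; exact zero_le_one)
  exact hne t ht ht0

/-! ### The no-retraction theorem -/

/-- A segment leaving the ball crosses the sphere, where `g` vanishes. -/
theorem lipschitzWith_indicator_of_zero_on_sphere {E F : Type*} [NormedAddCommGroup E]
    [NormedSpace ℝ E] [NormedAddCommGroup F] {g : E → F} {K : NNReal}
    (hg : LipschitzOnWith K g (closedBall 0 1)) (h0 : ∀ x ∈ sphere (0 : E) 1, g x = 0) :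
    LipschitzWith K ((closedBall (0 : E) 1).indicator g) := by
  classical
  have key : ∀ x ∈ closedBall (0 : E) 1, ∀ y ∉ closedBall (0 : E) 1,
      dist (g x) 0 ≤ K * dist x y := by
    intro x hx y hy
    rw [mem_closedBall_zero_iff] at hx hy
    have hc : ContinuousOn (fun t : ℝ => ‖AffineMap.lineMap x y t‖) (Icc 0 1) :=
      (AffineMap.lineMap_continuous.norm).continuousOn
    obtain ⟨t, ht, htn⟩ := intermediate_value_Icc (zero_le_one' ℝ) hc
      (show (1 : ℝ) ∈ _ by simpa using ⟨hx, (not_le.mp hy).le⟩)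
    set z : E := AffineMap.lineMap x y t with hz
    have hzs : z ∈ sphere (0 : E) 1 := by simpa using htn
    calc dist (g x) 0 = dist (g x) (g z) := by rw [h0 z hzs]
      _ ≤ K * dist x z :=
        hg.dist_le_mul x (by simpa using hx) z (sphere_subset_closedBall hzs)
      _ ≤ K * dist x y := by
        gcongr
        rw [hz, dist_left_lineMap, Real.norm_of_nonneg ht.1]
        exact mul_le_of_le_one_left dist_nonneg ht.2
  refine LipschitzWith.of_dist_le_mul fun x y => ?_
  by_cases hx : x ∈ closedBall (0 : E) 1 <;> by_cases hy : y ∈ closedBall (0 : E) 1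
  · rw [indicator_of_mem hx, indicator_of_mem hy]; exact hg.dist_le_mul x hx y hy
  · rw [indicator_of_mem hx, indicator_of_notMem hy]; exact key x hx y hy
  · rw [indicator_of_notMem hx, indicator_of_mem hy, dist_comm, dist_comm x]; exact key y hy x hx
  · rw [indicator_of_notMem hx, indicator_of_notMem hy, dist_self]; positivity

/-- The **no-retraction theorem** for continuously differentiable maps. -/
theorem not_exists_contDiffOn_retraction_closedBall_sphere {E : Type*} [NormedAddCommGroup E]
    [InnerProductSpace ℝ E] [FiniteDimensional ℝ E] {r : E → E} {U : Set E}
    (hU : IsOpen U) (hBU : closedBall 0 1 ⊆ U) (hr : ContDiffOn ℝ 1 r U)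
    (hid : ∀ x ∈ sphere (0 : E) 1, r x = x)
    (hnorm : ∀ x ∈ closedBall (0 : E) 1, ‖r x‖ = 1) : False := by
  have : CompleteSpace E := FiniteDimensional.complete ℝ E
  let _ : MeasurableSpace E := borel E
  have : BorelSpace E := ⟨rfl⟩
  set A : E → E →L[ℝ] E := fun x => fderiv ℝ r x - 1 with hAdef
  have hdiff : ∀ x ∈ closedBall (0 : E) 1, HasFDerivAt r (fderiv ℝ r x) x := fun x hx =>
    ((hr.differentiableOn one_ne_zero).differentiableAt (hU.mem_nhds (hBU hx))).hasFDerivAt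
  have hAc : ContinuousOn A (closedBall 0 1) :=
    ((hr.continuousOn_fderiv_of_isOpen hU le_rfl).mono hBU).sub continuousOn_const
  obtain ⟨K₀, hK₀⟩ := (isCompact_closedBall (0 : E) 1).exists_bound_of_continuousOn hAc
  set K : NNReal := K₀.toNNReal + 1 with hK
  have hKA : ∀ x ∈ closedBall (0 : E) 1, ‖A x‖ ≤ K := fun x hx => by
    have := hK₀ x hx
    have h2 := Real.le_coe_toNNReal K₀
    rw [hK]; push_cast; linarith
  have hKpos : (0 : ℝ) < K := by rw [hK]; positivity
  have hglip : LipschitzOnWith K (fun x => r x - x) (closedBall (0 : E) 1) :=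
    (convex_closedBall (0 : E) 1).lipschitzOnWith_of_nnnorm_hasFDerivWithin_le (f' := A)
      (fun x hx => ((hdiff x hx).sub (hasFDerivAt_id x)).hasFDerivWithinAt)
      (fun x hx => hKA x hx)
  set g : E → E := (closedBall (0 : E) 1).indicator fun x => r x - x with hg
  have hgL : LipschitzWith K g :=
    lipschitzWith_indicator_of_zero_on_sphere hglip fun x hx => by rw [hid x hx, sub_self]
  have hgout : ∀ x ∉ ball (0 : E) 1, g x = 0 := by
    intro x hx
    by_cases h : x ∈ closedBall (0 : E) 1
    · rw [hg, indicator_of_mem h, hid x, sub_self]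
      rw [mem_ball, not_lt] at hx
      exact le_antisymm h hx
    · rw [hg, indicator_of_notMem h]
  have hgin : ∀ x ∈ ball (0 : E) 1, HasFDerivAt g (A x) x := by
    intro x hx
    refine ((hdiff x (ball_subset_closedBall hx)).sub (hasFDerivAt_id x)).congr_of_eventuallyEq ?_
    filter_upwards [isOpen_ball.mem_nhds hx] with y hy
    rw [hg, indicator_of_mem (ball_subset_closedBall hy)]; rfl
  -- For small `t`, `id + t g` is a bijection fixing every point off the open ball, so it maps the
  -- ball onto itself; change variables.
  have hvol : ∀ t : ℝ, 0 < t → t * K < 1 →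
      ∫ x in ball (0 : E) 1, (1 + t • A x).det = volume.real (ball (0 : E) 1) := by
    intro t ht htK
    set F : E → E := fun x => x + t • g x with hF
    have happ : ApproximatesLinearOn F ((ContinuousLinearEquiv.refl ℝ E : E ≃L[ℝ] E) : E →L[ℝ] E)
        univ (t.toNNReal * K) := by
      rw [ApproximatesLinearOn.approximatesLinearOn_iff_lipschitzOnWith, lipschitzOnWith_univ]
      have : F - ⇑((ContinuousLinearEquiv.refl ℝ E : E ≃L[ℝ] E) : E →L[ℝ] E) =
          fun x => t • g x := by ext1 x; simp [hF]
      rw [this]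
      refine LipschitzWith.of_dist_le_mul fun x y => ?_
      rw [dist_smul₀, Real.norm_of_nonneg ht.le]
      push_cast
      rw [Real.coe_toNNReal _ ht.le, mul_assoc]
      exact mul_le_mul_of_nonneg_left (hgL.dist_le_mul x y) ht.le
    have hc : Subsingleton E ∨ t.toNNReal * K <
        ‖(((ContinuousLinearEquiv.refl ℝ E).symm : E ≃L[ℝ] E) : E →L[ℝ] E)‖₊⁻¹ := by
      rcases subsingleton_or_nontrivial E with h | h
      · exact Or.inl h
      · right
        have : (((ContinuousLinearEquiv.refl ℝ E).symm : E ≃L[ℝ] E) : E →L[ℝ] E) =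
          ContinuousLinearMap.id ℝ E := rfl
        rw [this, ← NNReal.coe_lt_coe]
        push_cast
        rw [Real.coe_toNNReal _ ht.le, ContinuousLinearMap.norm_id, inv_one]
        exact htK
    have hinj : Function.Injective F := injOn_univ.mp (happ.injOn hc)
    have hsurj : Function.Surjective F := happ.surjective hc
    have hFout : ∀ x ∉ ball (0 : E) 1, F x = x := fun x hx => by
      simp [hF, hgout x hx]
    have himg : F '' ball 0 1 = ball 0 1 := by
      ext y
      constructor
      · rintro ⟨x, hx, rfl⟩
        by_contra hy
        exact hy ((hinj (hFout _ hy)).symm ▸ hx)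
      · intro hy
        obtain ⟨x, rfl⟩ := hsurj y
        refine ⟨x, ?_, rfl⟩
        by_contra hx
        exact hx (hFout x hx ▸ hy)
    have hFd : ∀ x ∈ ball (0 : E) 1, HasFDerivWithinAt F (1 + t • A x) (ball 0 1) x := fun x hx =>
      ((hasFDerivAt_id x).add ((hgin x hx).const_smul t)).hasFDerivWithinAt
    have hcv := integral_image_eq_integral_abs_det_fderiv_smul volume measurableSet_ball hFd
      hinj.injOn (fun _ => (1 : ℝ))
    rw [himg] at hcv
    simp only [integral_const, smul_eq_mul, mul_one, measureReal_restrict_apply_univ] at hcv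
    rw [hcv]
    refine setIntegral_congr_fun measurableSet_ball fun x hx => ?_
    refine (abs_of_pos (ContinuousLinearMap.det_one_add_pos_of_norm_lt_one ?_)).symm
    rw [norm_smul, Real.norm_of_nonneg ht.le]
    exact (mul_le_mul_of_nonneg_left (hKA x (ball_subset_closedBall hx)) ht.le).trans_lt htK
  have hint : ∀ t : ℝ, IntegrableOn (fun x => (1 + t • A x).det) (ball (0 : E) 1) := fun t =>
    ((ContinuousLinearMap.continuous_det.comp_continuousOn
      (continuousOn_const.add (hAc.const_smul t))).integrableOn_compact
        (isCompact_closedBall (0 : E) 1)).mono_set ball_subset_closedBall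
  -- Since `‖r‖ = 1`, the image of the derivative is orthogonal to `r x ≠ 0`, so the derivative is
  -- not surjective.
  have hzero : ∀ x ∈ ball (0 : E) 1, (1 + A x).det = 0 := by
    intro x hx
    have h1 : 1 + A x = fderiv ℝ r x := by simp [hAdef]
    rw [h1]
    by_contra hne
    have hd := hdiff x (ball_subset_closedBall hx)
    have hc : HasFDerivAt (fun y => ‖r y‖ ^ 2) (0 : E →L[ℝ] ℝ) x := by
      refine (hasFDerivAt_const (1 : ℝ) x).congr_of_eventuallyEq ?_
      filter_upwards [isOpen_ball.mem_nhds hx] with y hy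
      rw [hnorm y (ball_subset_closedBall hy), one_pow]
    have heq := hd.norm_sq.unique hc
    have hbij : Function.Surjective (fderiv ℝ r x : E →ₗ[ℝ] E) :=
      (LinearMap.equivOfDetNeZero _ hne).surjective
    obtain ⟨v, hv⟩ := hbij (r x)
    have h2 := congrArg (fun L : E →L[ℝ] ℝ => L v) heq
    have hv' : fderiv ℝ r x v = r x := hv
    have h3 := hnorm x (ball_subset_closedBall hx)
    simp [hv', h3] at h2
  -- Distinct nodes with `v i * K < 1`, even at `i = 0`.
  set v : ℕ → ℝ := fun i => ((i + 2 : ℝ) * K)⁻¹ with hvdef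
  have hvinj : Function.Injective v := by
    intro i j hij
    have h := inv_injective hij
    have h' := mul_right_cancel₀ hKpos.ne' h
    exact Nat.cast_injective (R := ℝ) (add_right_cancel h')
  have hvpos : ∀ i, 0 < v i := fun i => by simp only [hvdef]; positivity
  have hvK : ∀ i, v i * K < 1 := fun i => by
    simp only [hvdef]
    rw [mul_inv, mul_assoc, inv_mul_cancel₀ hKpos.ne', mul_one]
    refine inv_lt_one_of_one_lt₀ ?_
    have : (0 : ℝ) ≤ i := i.cast_nonneg
    linarith
  have h0 : ∫ x in ball (0 : E) 1, (1 + A x).det = 0 := by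
    rw [setIntegral_congr_fun measurableSet_ball hzero]; simp
  -- The integral is polynomial in `t` and constant at the nodes, hence has the same value at `t =
  -- 1`.
  have h1 : ∫ x in ball (0 : E) 1, (1 + A x).det = volume.real (ball (0 : E) 1) := by
    rw [setIntegral_congr_fun measurableSet_ball fun x _ =>
      ContinuousLinearMap.det_one_add_eq_sum_lagrange (A x) hvinj.injOn]
    rw [integral_finsetSum _ fun i _ => (hint (v i)).const_mul _]
    simp_rw [integral_const_mul, hvol _ (hvpos _) (hvK _)]
    rw [← Finset.sum_mul, ← Polynomial.eval_finsetSum,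
      Lagrange.sum_basis hvinj.injOn ⟨0, Finset.mem_range.mpr (Nat.succ_pos _)⟩, Polynomial.eval_one, one_mul]
  have hpos : 0 < volume.real (ball (0 : E) 1) :=
    ENNReal.toReal_pos (measure_ball_pos _ _ one_pos).ne' measure_ball_lt_top.ne
  linarith

/-! ### Invariance of dimension -/

/-- A continuous map close to the identity on the closed unit ball has a zero there. -/
theorem exists_zero_of_norm_sub_id_le {E : Type*} [NormedAddCommGroup E]
    [InnerProductSpace ℝ E] [FiniteDimensional ℝ E] {h : E → E} (hc : Continuous h)
    (hh : ∀ x ∈ closedBall (0 : E) 1, ‖h x - x‖ ≤ 1 / 4) :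
    ∃ x ∈ closedBall (0 : E) 1, h x = 0 := by
  by_contra! hne
  obtain ⟨x₀, hx₀, hmin⟩ := (isCompact_closedBall (0 : E) 1).exists_isMinOn
    ⟨0, mem_closedBall_self zero_le_one⟩ hc.norm.continuousOn
  set δ := ‖h x₀‖ with hδ
  have hδpos : 0 < δ := norm_pos_iff.mpr (hne x₀ hx₀)
  have hδle : δ ≤ 1 / 4 := by
    have h1 : δ ≤ ‖h 0‖ := hmin (mem_closedBall_self zero_le_one)
    have h2 := hh 0 (mem_closedBall_self zero_le_one)
    rw [sub_zero] at h2
    exact h1.trans h2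
  obtain ⟨H, hH, hHh, -⟩ := hc.exists_contDiff_approx 1 (ε := fun _ => δ) continuous_const
    fun _ => hδpos
  have hH0 : ∀ x ∈ closedBall (0 : E) 1, H x ≠ 0 := by
    intro x hx h0
    have h1 : δ ≤ ‖h x‖ := hmin hx
    have h2 := hHh x
    rw [h0, dist_zero_left] at h2
    exact absurd h1 (not_le.mpr h2)
  let χ : ContDiffBump (0 : E) := ⟨3 / 4, 1, by norm_num, by norm_num⟩
  -- `G` is `H` on the ball of radius `3 / 4` and the identity on the unit sphere. In between, a
  -- zero would force `‖x‖ ≤ δ + 1 / 4 ≤ 1 / 2`.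
  set G : E → E := fun x => x + χ x • (H x - x) with hG
  have hGc : ContDiff ℝ 1 G := contDiff_id.add (χ.contDiff.smul (hH.sub contDiff_id))
  have hGne : ∀ x ∈ closedBall (0 : E) 1, G x ≠ 0 := by
    intro x hx h0
    by_cases hx' : x ∈ closedBall (0 : E) (3 / 4)
    · have : χ x = 1 := χ.one_of_mem_closedBall hx'
      simp only [hG, this, one_smul, add_sub_cancel] at h0
      exact hH0 x hx h0
    · have h1 : x = -(χ x • (H x - x)) := eq_neg_of_add_eq_zero_left h0
      have h2 : ‖H x - x‖ ≤ 1 / 2 := by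
        have h3 := norm_sub_le_norm_sub_add_norm_sub (H x) (h x) x
        have h4 := hHh x
        rw [dist_eq_norm] at h4
        have h5 := hh x hx
        linarith
      have h3 : ‖x‖ ≤ 1 / 2 := by
        rw [h1, norm_neg, norm_smul, Real.norm_of_nonneg χ.nonneg]
        exact (mul_le_of_le_one_left (norm_nonneg _) χ.le_one).trans h2
      rw [mem_closedBall_zero_iff] at hx'
      linarith
  refine not_exists_contDiffOn_retraction_closedBall_sphere (r := fun x => ‖G x‖⁻¹ • G x)
    (U := {x | G x ≠ 0}) (isOpen_ne_fun hGc.continuous continuous_const) hGne ?_ ?_ ?_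
  · exact ((hGc.contDiffOn.norm ℝ fun x hx => hx).inv fun x hx => norm_ne_zero_iff.mpr hx).smul
      hGc.contDiffOn
  · intro x hx
    have h0 : χ x = 0 := χ.zero_of_le_dist (by
      rw [mem_sphere] at hx; exact hx.ge)
    have hGx : G x = x := by simp [hG, h0]
    rw [mem_sphere_zero_iff_norm] at hx
    simp [hGx, hx]
  · intro x hx
    have := norm_ne_zero_iff.mpr (hGne x hx)
    rw [norm_smul, norm_inv, norm_norm, inv_mul_cancel₀ this]

/-- A ball of a Euclidean space does not embed into a space of smaller dimension. -/
theorem not_injOn_closedBall_of_finrank_lt.{u} {E : Type u} [NormedAddCommGroup E]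
    [InnerProductSpace ℝ E] [FiniteDimensional ℝ E] {m : ℕ} (hm : m < Module.finrank ℝ E)
    {f : E → EuclideanSpace ℝ (Fin m)} (hf : ContinuousOn f (closedBall 0 1)) :
    ¬ InjOn f (closedBall 0 1) := by
  intro hinj
  let f₀ : C(closedBall (0 : E) 1, EuclideanSpace ℝ (Fin m)) :=
    ⟨(closedBall (0 : E) 1).domRestrict f, continuousOn_iff_continuous_domRestrict.mp hf⟩
  have hemb : Topology.IsClosedEmbedding f₀ :=
    f₀.continuous.isClosedEmbedding (injOn_iff_injective.mp hinj)
  have hT : TietzeExtension.{u} (EuclideanSpace ℝ (Fin m)) :=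
    RCLike.instTietzeExtensionTVS (𝕜 := ℝ)
  have hT' : TietzeExtension.{0} E :=
    RCLike.instTietzeExtensionTVS (𝕜 := ℝ)
  -- Tietze extends both `f` and its inverse on the image. The `C¹` approximation `P` of the latter
  -- misses some small `c`, as `m < dim E`; the two errors `1 / 8` add up to the allowed `1 / 4`.
  obtain ⟨f₁, hf₁⟩ := ContinuousMap.exists_restrict_eq isClosed_closedBall f₀
  obtain ⟨G, hG⟩ := ContinuousMap.exists_extension hemb
    (⟨Subtype.val, continuous_subtype_val⟩ : C(closedBall (0 : E) 1, E))
  obtain ⟨P, hP, hPG, -⟩ := G.continuous.exists_contDiff_approx 1 (ε := fun _ => 1 / 8)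
    continuous_const fun _ => by norm_num
  obtain ⟨c, hc, hc0⟩ := (hP.dense_compl_range_of_finrank_lt_finrank
    (by simpa using hm)).exists_dist_lt 0 (show (0 : ℝ) < 1 / 8 by norm_num)
  rw [dist_zero_left] at hc0
  obtain ⟨x, -, hx⟩ := exists_zero_of_norm_sub_id_le (h := fun x => P (f₁ x) - c)
    ((hP.continuous.comp f₁.continuous).sub continuous_const) (by
      intro x hx
      have h1 : f₁ x = f₀ ⟨x, hx⟩ := congrArg (fun F => F ⟨x, hx⟩) hf₁
      have h2 : G (f₀ ⟨x, hx⟩) = x := congrArg (fun F => F ⟨x, hx⟩) hG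
      have h3 := hPG (f₁ x)
      rw [h1, h2, dist_eq_norm, ← h1] at h3
      have h4 := norm_sub_le (P (f₁ x) - x) c
      rw [sub_right_comm] at h4
      linarith)
  exact hc ⟨f₁ x, sub_eq_zero.mp hx⟩

theorem not_injOn_of_isOpen_of_finrank_lt {E : Type*} [NormedAddCommGroup E]
    [InnerProductSpace ℝ E] [FiniteDimensional ℝ E] {m : ℕ} (hm : m < Module.finrank ℝ E)
    {f : E → EuclideanSpace ℝ (Fin m)} {U : Set E} (hU : IsOpen U) (hne : U.Nonempty)
    (hf : ContinuousOn f U) : ¬ InjOn f U := by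
  intro hinj
  obtain ⟨a, ha⟩ := hne
  obtain ⟨ρ, hρ, hsub⟩ := nhds_basis_closedBall.mem_iff.mp (hU.mem_nhds ha)
  have hmap : MapsTo (fun x : E => a + ρ • x) (closedBall 0 1) U := by
    intro x hx
    refine hsub ?_
    rw [mem_closedBall_zero_iff] at hx
    rw [mem_closedBall, dist_self_add_left, norm_smul, Real.norm_of_nonneg hρ.le]
    nlinarith
  refine not_injOn_closedBall_of_finrank_lt hm (f := fun x => f (a + ρ • x))
    (hf.comp (by fun_prop) hmap) fun x hx y hy hxy => ?_
  have := add_left_cancel (hinj (hmap hx) (hmap hy) hxy)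
  exact smul_right_injective E hρ.ne' this

/-! ### Positive volume of open sets -/

theorem MeasureTheory.Measure.euclideanHausdorffMeasure_image_le_of_lipschitzOnWith
    {X Y : Type*} [MetricSpace X] [MeasurableSpace X] [BorelSpace X] [MetricSpace Y]
    [MeasurableSpace Y] [BorelSpace Y] {K : NNReal} {φ : X → Y} {s : Set X} (d : ℕ)
    (h : LipschitzOnWith K φ s) :
    (μHE[d] : Measure Y) (φ '' s) ≤ (K : ℝ≥0∞) ^ d * (μHE[d] : Measure X) s := by
  have h1 := h.hausdorffMeasure_image_le (d := d) d.cast_nonneg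
  rw [ENNReal.rpow_natCast] at h1
  simp only [Measure.euclideanHausdorffMeasure_def, Measure.smul_apply, ENNReal.smul_def,
    smul_eq_mul]
  rw [mul_left_comm]
  gcongr

/-- In adapted charts the inclusion is `u ↦ (u, 0)`, so the chart of `M` is locally the restriction
of a `C¹` map of the ambient space. -/
theorem exists_lipschitzOnWith_domChart {n N : ℕ} {M : Set (EuclideanSpace ℝ (Fin N))}
    [ChartedSpace (EuclideanSpace ℝ (Fin n)) M] {x : M}
    (h : IsImmersionAt 𝓘(ℝ, EuclideanSpace ℝ (Fin n)) 𝓘(ℝ, EuclideanSpace ℝ (Fin N)) ∞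
      (Subtype.val : M → EuclideanSpace ℝ (Fin N)) x) :
    ∃ K : NNReal, ∃ V ∈ nhds x, LipschitzOnWith K h.domChart V := by
  have hcod : ContDiffAt ℝ 1 h.codChart (x : EuclideanSpace ℝ (Fin N)) := by
    have := contMDiffAt_of_mem_maximalAtlas h.codChart_mem_maximalAtlas h.mem_codChart_source
    exact this.contDiffAt.of_le (by simp)
  have hfst : ContDiffAt ℝ 1
      (fun y => (h.equiv.symm (h.codChart y)).1) (x : EuclideanSpace ℝ (Fin N)) :=
    (contDiff_fst.comp h.equiv.symm.contDiff).contDiffAt.comp _ hcod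
  obtain ⟨K, t, ht, hK⟩ := hfst.exists_lipschitzOnWith
  refine ⟨K, Subtype.val ⁻¹' t ∩ h.domChart.source,
    Filter.inter_mem (continuous_subtype_val.continuousAt.preimage_mem_nhds ht)
      (h.domChart.open_source.mem_nhds h.mem_domChart_source), ?_⟩
  have heq : ∀ y ∈ h.domChart.source,
      h.domChart y = (h.equiv.symm (h.codChart (y : EuclideanSpace ℝ (Fin N)))).1 := by
    intro y hy
    have h1 := h.writtenInCharts (show h.domChart y ∈ _ by simpa using h.domChart.map_source hy)
    simp [h.domChart.left_inv hy] at h1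
    rw [h1]; simp
  intro y hy z hz
  rw [heq y hy.2, heq z hz.2]
  exact hK hy.1 hz.1

/-- Nonempty open subsets of an embedded manifold have positive volume. -/
theorem euclideanHausdorffMeasure_ne_zero_of_isOpen {n N : ℕ} {M : Set (EuclideanSpace ℝ (Fin N))}
    [ChartedSpace (EuclideanSpace ℝ (Fin n)) M]
    (hM : IsSmoothEmbedding 𝓘(ℝ, EuclideanSpace ℝ (Fin n)) 𝓘(ℝ, EuclideanSpace ℝ (Fin N)) ∞
      (Subtype.val : M → EuclideanSpace ℝ (Fin N)))
    {O : Set M} (hO : IsOpen O) (hne : O.Nonempty) : (μHE[n] : Measure M) O ≠ 0 := by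
  obtain ⟨x, hx⟩ := hne
  have h := hM.isImmersion.isImmersionAt x
  obtain ⟨K, V, hV, hK⟩ := exists_lipschitzOnWith_domChart h
  set S := O ∩ V ∩ h.domChart.source with hS
  have hSn : S ∈ nhds x := Filter.inter_mem (Filter.inter_mem (hO.mem_nhds hx) hV)
    (h.domChart.open_source.mem_nhds h.mem_domChart_source)
  have himg : h.domChart '' S ∈ nhds (h.domChart x) :=
    h.domChart.image_mem_nhds h.mem_domChart_source hSn
  have hpos : (μHE[n] : Measure (EuclideanSpace ℝ (Fin n))) (h.domChart '' S) ≠ 0 := by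
    rw [EuclideanSpace.euclideanHausdorffMeasure_eq_volume]
    exact (Measure.measure_pos_of_mem_nhds volume himg).ne'
  intro h0
  have h1 := Measure.euclideanHausdorffMeasure_image_le_of_lipschitzOnWith n
    (hK.mono (show S ⊆ V from fun y hy => hy.1.2))
  rw [measure_mono_null (show S ⊆ O from fun y hy => hy.1.1) h0, mul_zero] at h1
  exact hpos (le_antisymm h1 zero_le)

/-! ### Continuity from recall, injectivity from precision -/

/-- Ratio `1` rules out `μ t = 0` and `μ t = ∞`, where division gives `0`. Only the smaller set must
be null measurable to subtract. -/
theorem measure_diff_eq_zero_of_div_eq_one {X : Type*} [MeasurableSpace X] {μ : Measure X}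
    {s t : Set X} (hst : s ⊆ t) (hs : NullMeasurableSet s μ) (h : μ s / μ t = 1) :
    μ (t \ s) = 0 := by
  have h0 : μ t ≠ 0 := by
    intro h0
    rw [measure_mono_null hst h0, ENNReal.zero_div] at h
    exact zero_ne_one h
  have htop : μ t ≠ ⊤ := by
    intro htop
    rw [htop, ENNReal.div_top] at h
    exact zero_ne_one h
  have heq : μ s = μ t := (ENNReal.div_eq_one_iff h0 htop).mp h
  rw [measure_sdiff hst hs (heq ▸ htop), heq, tsub_self]

theorem PerfectRecallOn.continuousOn {X Y : Type*} [MetricSpace X] [MeasurableSpace X]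
    [BorelSpace X] [MetricSpace Y] {n : ℕ} {f : X → Y} {W : Set X}
    (hpos : ∀ O : Set X, IsOpen O → O.Nonempty → (μHE[n] : Measure X) O ≠ 0)
    (h : PerfectRecallOn n f W) : ContinuousOn f W := by
  have key : ∀ x ∈ W, ∀ ε > 0, ∃ δ > 0,
      (μHE[n] : Measure X) (ball x δ \ f ⁻¹' ball (f x) ε) = 0 := by
    intro x hx ε hε
    obtain ⟨δ, hδ, hnull, hr⟩ := h x hx ε hε
    refine ⟨δ, hδ, ?_⟩
    have := measure_diff_eq_zero_of_div_eq_one inter_subset_right hnull hr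
    rwa [sdiff_inter_self_eq_sdiff] at this
  rw [Metric.continuousOn_iff]
  intro x hx ε hε
  obtain ⟨δ, hδ, hδ0⟩ := key x hx (ε / 2) (half_pos hε)
  refine ⟨δ, hδ, fun z hz hzx => ?_⟩
  obtain ⟨η, hη, hη0⟩ := key z hz (ε / 2) (half_pos hε)
  have hO := hpos (ball x δ ∩ ball z η) (isOpen_ball.inter isOpen_ball)
    ⟨z, hzx, mem_ball_self hη⟩
  obtain ⟨y, hyO, hy⟩ : ∃ y ∈ ball x δ ∩ ball z η,
      y ∈ f ⁻¹' ball (f x) (ε / 2) ∩ f ⁻¹' ball (f z) (ε / 2) := by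
    by_contra! hcon
    refine hO (measure_mono_null (fun y hy => ?_) (measure_union_null hδ0 hη0))
    by_contra hy'
    simp only [mem_union, mem_sdiff, not_or, not_and, not_not] at hy'
    exact hcon y hy ⟨hy'.1 hy.1, hy'.2 hy.2⟩
  have h1 : dist (f y) (f x) < ε / 2 := hy.1
  have h2 : dist (f y) (f z) < ε / 2 := hy.2
  have h3 := dist_triangle_left (f z) (f x) (f y)
  linarith

theorem PerfectPrecisionOn.injOn {X Y : Type*} [MetricSpace X] [MeasurableSpace X]
    [BorelSpace X] [MetricSpace Y] {n : ℕ} {f : X → Y} {W : Set X}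
    (hpos : ∀ O : Set X, IsOpen O → O.Nonempty → (μHE[n] : Measure X) O ≠ 0)
    (hW : IsOpen W) (hf : ContinuousOn f W) (h : PerfectPrecisionOn n f W) : InjOn f W := by
  intro x hx y hy hxy
  by_contra hne
  have hd : 0 < dist x y := dist_pos.mpr hne
  obtain ⟨ε, hε, hεW⟩ := Metric.isOpen_iff.mp hW x hx
  set ρ := min ε (dist x y / 2) with hρ
  obtain ⟨s, hs, hp⟩ := h x hx ρ (lt_min hε (half_pos hd))
  have hopen : IsOpen (W ∩ f ⁻¹' ball (f x) s) := hf.isOpen_inter_preimage hW isOpen_ball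
  -- Precision assumes no measurability; it comes from continuity, as `ρ ≤ ε` keeps the ball inside
  -- `W`.
  have hmeas : MeasurableSet (f ⁻¹' ball (f x) s ∩ ball x ρ) := by
    have : f ⁻¹' ball (f x) s ∩ ball x ρ = W ∩ f ⁻¹' ball (f x) s ∩ ball x ρ := by
      ext z
      constructor
      · exact fun hz => ⟨⟨hεW (ball_subset_ball (min_le_left _ _) hz.2), hz.1⟩, hz.2⟩
      · exact fun hz => ⟨hz.1.2, hz.2⟩
    rw [this]
    exact (hopen.inter isOpen_ball).measurableSet
  have h0 := measure_diff_eq_zero_of_div_eq_one inter_subset_left hmeas.nullMeasurableSet hp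
  rw [sdiff_self_inter] at h0
  -- This open set contains `y`, because `ρ ≤ dist x y / 2`, yet lies in a null set.
  refine hpos (W ∩ f ⁻¹' ball (f x) s ∩ (closedBall x ρ)ᶜ)
    (hopen.inter isClosed_closedBall.isOpen_compl) ⟨y, ⟨hy, ?_⟩, ?_⟩
    (measure_mono_null ?_ h0)
  · rw [mem_preimage, ← hxy]
    exact mem_ball_self hs
  · rw [mem_compl_iff, mem_closedBall, not_le, dist_comm]
    exact (min_le_right _ _).trans_lt (half_lt_self hd)
  · exact fun z hz => ⟨hz.1.2, fun hz' => hz.2 (ball_subset_closedBall hz')⟩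

theorem mainTheorem1 {n m N : ℕ} (hmn : m < n)
    (M : Set (EuclideanSpace ℝ (Fin N)))
    [ChartedSpace (EuclideanSpace ℝ (Fin n)) M]
    [IsManifold 𝓘(ℝ, EuclideanSpace ℝ (Fin n)) ∞ M]
    (hM : IsSmoothEmbedding 𝓘(ℝ, EuclideanSpace ℝ (Fin n)) 𝓘(ℝ, EuclideanSpace ℝ (Fin N)) ∞
      (Subtype.val : M → EuclideanSpace ℝ (Fin N)))
    (f : M → EuclideanSpace ℝ (Fin m))
    (W : Set M) (hWopen : IsOpen W) (hWne : W.Nonempty) :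
    ¬ (PerfectPrecisionOn n f W ∧ PerfectRecallOn n f W) := by
  rintro ⟨hprec, hrec⟩
  have hpos : ∀ O : Set M, IsOpen O → O.Nonempty → (μHE[n] : Measure M) O ≠ 0 :=
    fun O hO hne => euclideanHausdorffMeasure_ne_zero_of_isOpen hM hO hne
  have hcont := hrec.continuousOn hpos
  have hinj := hprec.injOn hpos hWopen hcont
  obtain ⟨w, hw⟩ := hWne
  let φ := chartAt (EuclideanSpace ℝ (Fin n)) w
  have hmaps : MapsTo φ.symm (φ.target ∩ φ.symm ⁻¹' W) W := fun x hx => hx.2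
  refine not_injOn_of_isOpen_of_finrank_lt (by simpa using hmn) (f := f ∘ φ.symm)
    (φ.isOpen_inter_preimage_symm hWopen)
    ⟨φ w, φ.map_source (mem_chart_source _ w), ?_⟩
    (hcont.comp (φ.continuousOn_symm.mono inter_subset_left) hmaps)
    (hinj.comp (φ.symm.injOn.mono inter_subset_left) hmaps)
  rw [mem_preimage, φ.left_inv (mem_chart_source _ w)]
  exact hw
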